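/- Let $0<p<1$. For every block length $n$ let $\mathbb F_{(n)}$ be a finite field, with $m_n$ elements, such that $p>(1-p)/(m_n-1)$. A word $c\in\mathbb F_{(n)}^n$ is sent over $n$ independent uses of the $m_n$-ary symmetric channel, $\Pr(r\mid c)=p$ if $r=c$ and $(1-p)/(m_n-1)$ if $r\ne c$. The error pattern $x^n\in\{0,1\}^n$ has $x_i=1$ if and only if $r_i=c_i$ (so it is i.i.d. with $\Pr(x_i=1)=p$). Multiple errors-and-erasures decoding mBM-1 with a set $\mathcal B\subseteq\{0,1\}^n$ of erasure patterns makes $|\mathcal B|$ decoding attempts; let $d(x^n,\hat x^n)=\sum_i\delta(x_i,\hat x_i)$ with $\delta(0,0)=1$, $\delta(0,1)=2$, $\delta(1,0)=1$, $\delta(1,1)=0$, and, for a threshold $\Delta$, let $p_e(\mathcal B,\Delta)=\Pr\bigl(\min_{\hat x^n\in\mathcal B}d(x^n,\hat x^n)>\Delta\bigr)$. Let $N\ge1$ be an integer and let $R$, $D$ be real with $0<D<N$. An (unnormalized) exponent $F$ is achievable with $2^R$ decoding attempts at distortion $D$ if there are sets $\mathcal B_n\subseteq\{0,1\}^n$ with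 $|\mathcal B_n|\le 2^{nR/N}$ for all $n$ such that for every $\epsilon>0$ and all sufficiently large $n$, $p_e(\mathcal B_n,nD/N)\le 2^{-n(F/N-\epsilon)}$. Let $H(u)=-u\log_2u-(1-u)\log_2(1-u)$, $D_{KL}(u\|p)=u\log_2\frac up+(1-u)\log_2\frac{1-u}{1-p}$ and $h(u)=H(u)-H(u+\frac DN-1)$. Assume $R\in(0,\,N\,H(1-\frac DN)]$. Then $h$ is a bijection from $[1-\frac DN,\,1-\frac D{2N})$ onto $(0,H(1-\frac DN)]$; let $h^{-1}$ be its inverse. If $h^{-1}(R/N)\le p$, then the maximum achievable exponent is $$F=N\,D_{KL}\bigl(h^{-1}(R/N)\,\big\|\,p\bigr),$$ that is, $F$ is achievable and no larger exponent is; moreover, for all sets $\mathcal B_n\subseteq\{0,1\}^n$ with $|\mathcal B_n|\le2^{nR/N}$ and every $\epsilon>0$, $p_e(\mathcal B_n,nD/N)\ge2^{-n(F/N+\epsilon)}$ for all sufficiently large $n$. -/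

import Mathlib

open Filter

noncomputable section

/-- Binary entropy in bits. -/
def H₂ (u : ℝ) : ℝ := Real.binEntropy u / Real.log 2

/-- Binary Kullback-Leibler divergence in bits (used for `0 < u < 1` and `0 < p < 1` only). -/
def klBits (u p : ℝ) : ℝ :=
  u * Real.logb 2 (u / p) + (1 - u) * Real.logb 2 ((1 - u) / (1 - p))

/-- `h(u) = H(u) - H(u + d - 1)`, where `d` is the distortion per letter. -/
def hRate (d u : ℝ) : ℝ := H₂ u - H₂ (u + d - 1)

/-- The interval `[1 - d, 1 - d/2)` on which `h` is inverted. -/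
def hDomain (d : ℝ) : Set ℝ := Set.Ico (1 - d) (1 - d / 2)

/-- The inverse of `h : [1 - d, 1 - d/2) → (0, H(1 - d)]`. -/
def hInv (d r : ℝ) : ℝ := Function.invFunOn (hRate d) (hDomain d) r

/-- The letter distortion of mBM-1; row: error-pattern letter (`1` = hard decision correct),
column: erasure-pattern letter (`0` = erase, `1` = keep the hard decision). -/
def δmBM1 : Matrix (Fin 2) (Fin 2) ℝ := !![1, 2; 1, 0]

/-- Total distortion between an error pattern and an erasure pattern. -/
def distortion {n : ℕ} (x y : Fin n → Fin 2) : ℝ := ∑ i, δmBM1 (x i) (y i)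

/-- Transition probability `Pr(r | c)` of the `m`-ary symmetric channel, `m = |𝔽|`. -/
def mSC (𝔽 : Type*) [Fintype 𝔽] [DecidableEq 𝔽] (p : ℝ) (c r : 𝔽) : ℝ :=
  if r = c then p else (1 - p) / ((Fintype.card 𝔽 : ℝ) - 1)

/-- Error pattern: the hard decision at each index is the received symbol, and the letter is `1`
exactly if it is correct. -/
def errorPattern {𝔽 : Type*} [DecidableEq 𝔽] {n : ℕ} (c r : Fin n → 𝔽) : Fin n → Fin 2 :=
  fun i => if r i = c i then 1 else 0

open Classical in
/-- `p_e = Pr(min_{y ∈ B} d(x, y) > D)`, where `x` is the random error pattern when the word `c` is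
sent over `n` independent uses of the `m`-ary symmetric channel. -/
def errorProb {𝔽 : Type*} [Fintype 𝔽] [DecidableEq 𝔽] {n : ℕ} (p D : ℝ)
    (B : Finset (Fin n → Fin 2)) (c : Fin n → 𝔽) : ℝ :=
  ∑ r : Fin n → 𝔽,
    if ∀ y ∈ B, D < distortion (errorPattern c r) y then ∏ i, mSC 𝔽 p (c i) (r i) else 0

/-- A choice, for every block length `n`, of a set of erasure patterns with at most `2 ^ (n ρ)`
elements, i.e. at most that many decoding attempts. -/
def HasRate (ρ : ℝ) (B : ∀ n : ℕ, Finset (Fin n → Fin 2)) : Prop :=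
  ∀ n : ℕ, ((B n).card : ℝ) ≤ (2 : ℝ) ^ ((n : ℝ) * ρ)

/-- `R`, `D`, `F` are unnormalized, at block length `N`.  The exponent `F` is achievable with `2 ^ R`
attempts if, at the rate `R / N` and the distortion `D / N` per letter, suitable sets of erasure
patterns have error probability at most `2 ^ (-n (F / N - ε))` for all large block lengths `n`,
for every `ε > 0`, whatever word is sent. -/
def ExponentAchievable (𝔽 : ℕ → Type*) [∀ n, Fintype (𝔽 n)] [∀ n, DecidableEq (𝔽 n)]
    (p : ℝ) (N : ℕ) (R D F : ℝ) : Prop :=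
  ∃ B : ∀ n : ℕ, Finset (Fin n → Fin 2), HasRate (R / N) B ∧
    ∀ ε : ℝ, 0 < ε → ∀ᶠ n : ℕ in atTop, ∀ c : Fin n → 𝔽 n,
      errorProb p ((n : ℝ) * (D / N)) (B n) c ≤ (2 : ℝ) ^ (-((n : ℝ) * (F / N - ε)))

/-- No choice of at most `2 ^ R` attempts beats the exponent `F`: for every choice of the sets of
erasure patterns and every `ε > 0`, the error probability is at least `2 ^ (-n (F / N + ε))` for all
large block lengths `n`. -/
def ExponentConverse (𝔽 : ℕ → Type*) [∀ n, Fintype (𝔽 n)] [∀ n, DecidableEq (𝔽 n)]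
    (p : ℝ) (N : ℕ) (R D F : ℝ) : Prop :=
  ∀ B : ∀ n : ℕ, Finset (Fin n → Fin 2), HasRate (R / N) B →
    ∀ ε : ℝ, 0 < ε → ∀ᶠ n : ℕ in atTop, ∀ c : Fin n → 𝔽 n,
      (2 : ℝ) ^ (-((n : ℝ) * (F / N + ε))) ≤ errorProb p ((n : ℝ) * (D / N)) (B n) c

end

open Finset Topology

noncomputable section

/-! Write `d = D / N`, `r = R / N`, `s` for the set of correct letters and `t` for the set of kept
ones. The channel enters only through `s`, which contains each index independently with probability
`p`. The distortion is `n - #s + #(s ∆ t)`. So on the layer `#s ≈ v n`, decoding succeeds for `t`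
exactly when `s` lies in a Hamming ball of radius about `(v + d - 1) n` around `t`, and `h(v) = H(v)
- H(v + d - 1)` is the exponential rate of (layer size) / (ball size). It decreases in `v`, and `u =
h⁻¹(r)` is the layer where the allowed number of attempts is just enough.

Achievability: greedy covering shows that the ball count is attained up to a subexponential factor,
so a layer slightly above `u n` can be covered (`eventually_exists_cover`). Distortion decreases as
`s` grows, so all higher layers are covered with it. Only patterns with few correct letters fail,
and since `u ≤ p` the Chernoff bound `lowerTail_le` gives probability about `2 ^ (-n D(u‖p))`.

Converse: for `v < u` the balls are too few to cover even half of the layer at `v n`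
(`eventually_half_uncovered`). Half of that layer has probability about `2 ^ (-n D(v‖p))`; let `v →
u`. -/

/-! ### Distortion in terms of sets -/

/-- The pattern that is `1` exactly on `s`. -/
def indicatorPattern {n : ℕ} (s : Finset (Fin n)) : Fin n → Fin 2 :=
  fun i => if i ∈ s then 1 else 0

/-- The set of indices where a pattern is `1`. -/
def patternSupport {n : ℕ} (x : Fin n → Fin 2) : Finset (Fin n) := {i | x i = 1}

lemma indicatorPattern_patternSupport {n : ℕ} (x : Fin n → Fin 2) :
    indicatorPattern (patternSupport x) = x := by
  funext i
  simp only [indicatorPattern, patternSupport, mem_filter, mem_univ, true_and]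
  split_ifs with h
  · exact h.symm
  · omega

lemma distortion_indicatorPattern {n : ℕ} (s t : Finset (Fin n)) :
    distortion (indicatorPattern s) (indicatorPattern t) = n - #(t ∩ s) + #(t \ s) := by
  have h : ∀ i, δmBM1 (indicatorPattern s i) (indicatorPattern t i) =
      1 - (if i ∈ t ∩ s then 1 else 0) + (if i ∈ t \ s then 1 else 0) := by
    intro i
    by_cases hs : i ∈ s <;> by_cases ht : i ∈ t <;> simp [δmBM1, indicatorPattern, hs, ht]
    norm_num
  unfold distortion
  simp only [h, sum_add_distrib, sum_sub_distrib, sum_boole, filter_mem_eq_inter, univ_inter]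
  simp

/-- On a layer of fixed `#s` the distortion is Hamming distance plus a constant; this turns the
converse into counting Hamming balls. -/
lemma distortion_eq_symmDiff {n : ℕ} (s t : Finset (Fin n)) :
    distortion (indicatorPattern s) (indicatorPattern t) = n - #s + #(symmDiff s t) := by
  rw [distortion_indicatorPattern]
  have h1 : #(symmDiff s t) = #(s \ t) + #(t \ s) := by
    rw [symmDiff_def, sup_eq_union, card_union_of_disjoint disjoint_sdiff_sdiff]
  have h2 : #(s \ t) + #(s ∩ t) = #s := card_sdiff_add_card_inter s t
  rw [inter_comm t s, h1, ← h2]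
  push_cast
  ring

/-- Correcting a letter lowers the cost of keeping it and leaves the cost of erasing it unchanged.
Hence covering one layer covers every layer above it. -/
lemma distortion_anti {n : ℕ} {s s' : Finset (Fin n)} (h : s ⊆ s') (y : Fin n → Fin 2) :
    distortion (indicatorPattern s') y ≤ distortion (indicatorPattern s) y := by
  rw [← indicatorPattern_patternSupport y, distortion_indicatorPattern,
    distortion_indicatorPattern]
  have h1 : #(patternSupport y ∩ s) ≤ #(patternSupport y ∩ s') :=
    card_le_card (inter_subset_inter_left h)
  have h2 : #(patternSupport y \ s') ≤ #(patternSupport y \ s) :=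
    card_le_card (sdiff_subset_sdiff le_rfl h)
  have h1' : (#(patternSupport y ∩ s) : ℝ) ≤ #(patternSupport y ∩ s') := by exact_mod_cast h1
  have h2' : (#(patternSupport y \ s') : ℝ) ≤ #(patternSupport y \ s) := by exact_mod_cast h2
  linarith

/-! ### Reduction from the channel to random subsets -/

open Classical in
/-- Probability that a random subset, containing each index independently with probability `p`,
is not covered by `B` within distortion `D`. -/
def missProb {n : ℕ} (p D : ℝ) (B : Finset (Fin n → Fin 2)) : ℝ :=
  ∑ s : Finset (Fin n),
    if ∀ y ∈ B, D < distortion (indicatorPattern s) y then p ^ #s * (1 - p) ^ (n - #s) else 0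

/-- The words agreeing with `c` exactly on `s` form a product set, so the sum factors; the `m - 1`
wrong symbols at an index contribute `1 - p` together. -/
lemma sum_prod_mSC_agreement {𝔽 : Type*} [Fintype 𝔽] [DecidableEq 𝔽] [Nontrivial 𝔽] {n : ℕ}
    (p : ℝ) (c : Fin n → 𝔽) (s : Finset (Fin n)) :
    ∑ r : Fin n → 𝔽 with ({i | r i = c i} : Finset (Fin n)) = s, ∏ i, mSC 𝔽 p (c i) (r i) =
      p ^ #s * (1 - p) ^ (n - #s) := by
  have hset : ({r : Fin n → 𝔽 | ({i | r i = c i} : Finset (Fin n)) = s} : Finset _) =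
      Fintype.piFinset fun i => if i ∈ s then {c i} else univ.erase (c i) := by
    ext r
    simp only [mem_filter, mem_univ, true_and, Fintype.mem_piFinset, Finset.ext_iff]
    refine forall_congr' fun i => ?_
    by_cases hi : i ∈ s <;> simp [hi]
  have hcard : (0 : ℝ) < (Fintype.card 𝔽 : ℝ) - 1 := by
    have : (1 : ℝ) < Fintype.card 𝔽 := by exact_mod_cast Fintype.one_lt_card
    linarith
  have hletter : ∀ i, (∑ a ∈ (if i ∈ s then {c i} else univ.erase (c i)), mSC 𝔽 p (c i) a) =
      if i ∈ s then p else 1 - p := by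
    intro i
    split_ifs with hi
    · simp [mSC]
    · rw [sum_congr rfl (g := fun _ => (1 - p) / ((Fintype.card 𝔽 : ℝ) - 1))
        (fun a ha => by simp [mSC, ne_of_mem_erase ha])]
      rw [sum_const, card_erase_of_mem (mem_univ _), card_univ, nsmul_eq_mul,
        Nat.cast_sub Fintype.card_pos]
      push_cast
      field_simp
  rw [hset, ← prod_univ_sum (fun i => if i ∈ s then {c i} else univ.erase (c i))
    (fun i a => mSC 𝔽 p (c i) a)]
  simp only [hletter, prod_ite, prod_const]
  rw [filter_mem_eq_inter, univ_inter, filter_not, filter_mem_eq_inter, univ_inter,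
    ← compl_eq_univ_sdiff, card_compl, Fintype.card_fin]

lemma errorProb_eq_missProb {𝔽 : Type*} [Fintype 𝔽] [DecidableEq 𝔽] [Nontrivial 𝔽] {n : ℕ}
    (p D : ℝ) (B : Finset (Fin n → Fin 2)) (c : Fin n → 𝔽) :
    errorProb p D B c = missProb p D B := by
  classical
  unfold errorProb missProb
  rw [← sum_fiberwise univ (fun r : Fin n → 𝔽 => ({i | r i = c i} : Finset (Fin n)))]
  refine sum_congr rfl fun s _ => ?_
  have hpat : ∀ r : Fin n → 𝔽, ({i | r i = c i} : Finset (Fin n)) = s →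
      errorPattern c r = indicatorPattern s := by
    rintro r rfl
    funext i
    simp [errorPattern, indicatorPattern]
  rw [← sum_prod_mSC_agreement p c s]
  split_ifs with h
  · refine sum_congr rfl fun r hr => ?_
    rw [hpat r (mem_filter.mp hr).2, if_pos h]
  · refine sum_eq_zero fun r hr => ?_
    rw [hpat r (mem_filter.mp hr).2, if_neg h]

lemma sum_subsetProb (n : ℕ) (p : ℝ) :
    ∑ s : Finset (Fin n), p ^ #s * (1 - p) ^ (n - #s) = 1 := by
  have := Fintype.sum_pow_mul_eq_add_pow (Fin n) p (1 - p)
  simpa using this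

lemma missProb_le_sum {n : ℕ} {p D : ℝ} (hp0 : 0 ≤ p) (hp1 : p ≤ 1) {B : Finset (Fin n → Fin 2)}
    {S : Finset (Finset (Fin n))}
    (hS : ∀ s ∉ S, ∃ y ∈ B, distortion (indicatorPattern s) y ≤ D) :
    missProb p D B ≤ ∑ s ∈ S, p ^ #s * (1 - p) ^ (n - #s) := by
  classical
  have hq : 0 ≤ 1 - p := sub_nonneg.mpr hp1
  unfold missProb
  rw [← sum_filter_add_sum_filter_not univ (· ∈ S)]
  rw [sum_eq_zero (s := univ.filter (· ∉ S)), add_zero]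
  · rw [filter_mem_eq_inter, univ_inter]
    refine sum_le_sum fun s _ => ?_
    split_ifs
    · exact le_rfl
    · positivity
  · intro s hs
    obtain ⟨y, hy, hd⟩ := hS s (mem_filter.mp hs).2
    exact if_neg fun h => absurd (h y hy) hd.not_gt

lemma sum_le_missProb {n : ℕ} {p D : ℝ} (hp0 : 0 ≤ p) (hp1 : p ≤ 1) {B : Finset (Fin n → Fin 2)}
    {S : Finset (Finset (Fin n))}
    (hS : ∀ s ∈ S, ∀ y ∈ B, D < distortion (indicatorPattern s) y) :
    ∑ s ∈ S, p ^ #s * (1 - p) ^ (n - #s) ≤ missProb p D B := by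
  classical
  have hq : 0 ≤ 1 - p := sub_nonneg.mpr hp1
  unfold missProb
  rw [← sum_filter]
  exact sum_le_sum_of_subset_of_nonneg (fun s hs => mem_filter.mpr ⟨mem_univ _, hS s hs⟩)
    fun s _ _ => by positivity

/-! ### Chernoff bound and volume of Hamming balls -/

/-- Binary Kullback-Leibler divergence in nats. -/
def klNats (u p : ℝ) : ℝ := u * Real.log (u / p) + (1 - u) * Real.log ((1 - u) / (1 - p))

lemma klBits_eq (u p : ℝ) : klBits u p = klNats u p / Real.log 2 := by
  unfold klBits klNats Real.logb
  ring

lemma two_rpow_eq_exp (x : ℝ) : (2 : ℝ) ^ x = Real.exp (x * Real.log 2) := by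
  rw [Real.rpow_def_of_pos two_pos, mul_comm]

/-- Chernoff bound for the lower tail of the binomial distribution. -/
lemma lowerTail_le {n : ℕ} {v p : ℝ} (hv : 0 < v) (hvp : v ≤ p) (hp : p < 1) :
    ∑ s : Finset (Fin n) with (#s : ℝ) ≤ v * n, p ^ #s * (1 - p) ^ (n - #s) ≤
      Real.exp (-(n * klNats v p)) := by
  have hp0 : 0 < p := hv.trans_le hvp
  have hv1 : 0 < 1 - v := by linarith
  have hp1 : 0 < 1 - p := by linarith
  -- Change of measure from `p` to `v`: as `v ≤ p`, the likelihood ratio is nondecreasing in `#s`,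
  -- and at `#s = v n` it equals the exponential on the right.
  have hterm : ∀ s ∈ ({s | (#s : ℝ) ≤ v * n} : Finset (Finset (Fin n))),
      p ^ #s * (1 - p) ^ (n - #s) ≤
        Real.exp (-(n * klNats v p)) * (v ^ #s * (1 - v) ^ (n - #s)) := by
    intro s hs
    have hs := (mem_filter.mp hs).2
    have hcard : #s ≤ n := by simpa using card_le_univ s
    rw [← Real.log_le_log_iff (by positivity) (by positivity),
      Real.log_mul (by positivity) (by positivity), Real.log_mul (by positivity) (by positivity),
      Real.log_exp, Real.log_mul (by positivity) (by positivity), Real.log_pow, Real.log_pow,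
      Real.log_pow, Real.log_pow, Nat.cast_sub hcard, klNats, Real.log_div hv.ne' hp0.ne',
      Real.log_div hv1.ne' hp1.ne']
    have h1 : Real.log v ≤ Real.log p := Real.log_le_log hv hvp
    have h2 : Real.log (1 - p) ≤ Real.log (1 - v) := Real.log_le_log hp1 (by linarith)
    nlinarith [mul_nonneg (sub_nonneg.mpr hs) (add_nonneg (sub_nonneg.mpr h1) (sub_nonneg.mpr h2))]
  refine (sum_le_sum hterm).trans ?_
  rw [← mul_sum]
  refine mul_le_of_le_one_right (Real.exp_pos _).le ?_
  refine le_trans ?_ (sum_subsetProb n v).le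
  exact sum_le_sum_of_subset_of_nonneg (filter_subset _ _) fun s _ _ => by positivity

lemma klNats_half {s : ℝ} (h0 : 0 < s) (h1 : s < 1) :
    klNats s (1 / 2) = Real.log 2 - Real.binEntropy s := by
  have h2 : 0 < 1 - s := by linarith
  rw [klNats, Real.binEntropy, Real.log_inv, Real.log_inv, show (1 : ℝ) - 1 / 2 = 1 / 2 by norm_num,
    Real.log_div h0.ne' (by norm_num), Real.log_div h2.ne' (by norm_num), one_div, Real.log_inv]
  ring

/-- The Chernoff bound at `p = 1 / 2`, where every subset has weight `2 ^ (-n)`. -/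
lemma card_hammingBall_zero_le {n : ℕ} {σ : ℝ} (h0 : 0 < σ) (h1 : σ ≤ 1 / 2) :
    (#{s : Finset (Fin n) | (#s : ℝ) ≤ σ * n} : ℝ) ≤ Real.exp (n * Real.binEntropy σ) := by
  have h := lowerTail_le (n := n) h0 h1 (by norm_num)
  have hterm : ∀ s ∈ ({s | (#s : ℝ) ≤ σ * n} : Finset (Finset (Fin n))),
      ((1 : ℝ) / 2) ^ #s * (1 - 1 / 2) ^ (n - #s) = Real.exp (-(n * Real.log 2)) := by
    intro s _
    have hcard : #s ≤ n := by simpa using card_le_univ s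
    rw [show (1 : ℝ) - 1 / 2 = 1 / 2 by norm_num, ← pow_add, Nat.add_sub_cancel' hcard,
      Real.exp_neg, mul_comm, Real.exp_mul, Real.exp_log two_pos, Real.rpow_natCast]
    simp
  rw [sum_congr rfl hterm, sum_const, nsmul_eq_mul, klNats_half h0 (by linarith)] at h
  have hpos := Real.exp_pos (n * Real.log 2)
  calc _ = (#{s : Finset (Fin n) | (#s : ℝ) ≤ σ * n} : ℝ) * Real.exp (-(n * Real.log 2)) *
        Real.exp (n * Real.log 2) := by rw [mul_assoc, ← Real.exp_add]; simp
    _ ≤ Real.exp (-(n * (Real.log 2 - Real.binEntropy σ))) * Real.exp (n * Real.log 2) := by gcongr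
    _ = _ := by rw [← Real.exp_add]; ring_nf

lemma card_hammingBall_le {n : ℕ} {σ : ℝ} (h0 : 0 < σ) (h1 : σ ≤ 1 / 2) (t : Finset (Fin n)) :
    (#{s : Finset (Fin n) | (#(symmDiff s t) : ℝ) ≤ σ * n} : ℝ) ≤
      Real.exp (n * Real.binEntropy σ) := by
  refine le_trans ?_ (card_hammingBall_zero_le (n := n) h0 h1)
  refine Nat.cast_le.mpr (card_le_card_of_injOn (fun s => symmDiff s t) ?_ ?_)
  · intro s hs
    simpa using hs
  · intro s _ s' _ h
    exact symmDiff_left_injective t h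

/-! ### Greedy covering -/

/-- Greedy covering: if each element of `X` is covered by at least a fraction `q` of `Y`, then `L`
elements of `Y` leave at most a fraction `(1 - q) ^ L` of `X` uncovered. -/
lemma exists_card_uncovered_le {α β : Type*} [DecidableEq α] [DecidableEq β] (X : Finset α)
    (Y : Finset β) (hY : Y.Nonempty) (cov : α → β → Prop) [∀ x, DecidablePred (cov x)] {q : ℝ}
    (hq : q ≤ 1) (h : ∀ x ∈ X, q * #Y ≤ #{y ∈ Y | cov x y}) (L : ℕ) :
    ∃ B ⊆ Y, #B ≤ L ∧ (#{x ∈ X | ∀ y ∈ B, ¬ cov x y} : ℝ) ≤ (1 - q) ^ L * #X := by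
  induction L with
  | zero => exact ⟨∅, by simp⟩
  | succ L ih =>
    obtain ⟨B, hBY, hBL, hB⟩ := ih
    set U := {x ∈ X | ∀ y ∈ B, ¬ cov x y} with hU
    have hdouble : ∑ y ∈ Y, (#{x ∈ U | cov x y} : ℝ) = ∑ x ∈ U, (#{y ∈ Y | cov x y} : ℝ) := by
      exact_mod_cast (sum_card_bipartiteAbove_eq_sum_card_bipartiteBelow cov (s := U) (t := Y)).symm
    have hsum : ∑ y ∈ Y, q * #U ≤ ∑ y ∈ Y, (#{x ∈ U | cov x y} : ℝ) := by
      rw [hdouble, sum_const, nsmul_eq_mul]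
      calc (#Y : ℝ) * (q * #U) = ∑ x ∈ U, q * #Y := by rw [sum_const, nsmul_eq_mul]; ring
        _ ≤ _ := sum_le_sum fun x hx => h x (mem_filter.mp hx).1
    obtain ⟨y, hyY, hy⟩ := exists_le_of_sum_le hY hsum
    refine ⟨insert y B, insert_subset hyY hBY, (card_insert_le _ _).trans (by omega), ?_⟩
    have hsub : {x ∈ X | ∀ z ∈ insert y B, ¬ cov x z} = U \ {x ∈ U | cov x y} := by
      ext x
      simp only [hU, mem_filter, mem_insert, forall_eq_or_imp, Finset.mem_sdiff]
      tauto
    rw [hsub, card_sdiff_of_subset (filter_subset _ _),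
      Nat.cast_sub (card_le_card (filter_subset _ _))]
    calc (#U : ℝ) - #{x ∈ U | cov x y} ≤ (1 - q) * #U := by linarith
      _ ≤ (1 - q) * ((1 - q) ^ L * #X) :=
        mul_le_mul_of_nonneg_left hB (sub_nonneg.mpr hq)
      _ = _ := by ring

/-- After `⌈n / q⌉` greedy choices at most `exp (-n) * 2 ^ n < 1` elements are uncovered, hence
none. -/
lemma exists_cover {α β : Type*} [DecidableEq α] [DecidableEq β] (X : Finset α)
    (Y : Finset β) (hY : Y.Nonempty) (cov : α → β → Prop) [∀ x, DecidablePred (cov x)] {q : ℝ}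
    (hq0 : 0 < q) (hq : q ≤ 1) (h : ∀ x ∈ X, q * #Y ≤ #{y ∈ Y | cov x y}) {n : ℕ} (hn : 0 < n)
    (hX : #X ≤ 2 ^ n) :
    ∃ B ⊆ Y, (#B : ℝ) ≤ n / q + 1 ∧ ∀ x ∈ X, ∃ y ∈ B, cov x y := by
  obtain ⟨B, hBY, hBL, hB⟩ := exists_card_uncovered_le X Y hY cov hq h ⌈n / q⌉₊
  refine ⟨B, hBY, ?_, ?_⟩
  · have h1 : (#B : ℝ) ≤ ⌈n / q⌉₊ := by exact_mod_cast hBL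
    exact h1.trans (Nat.ceil_lt_add_one (by positivity)).le
  · have hlt : (1 - q) ^ ⌈n / q⌉₊ * (#X : ℝ) < 1 := by
      have h1 : (1 - q) ^ ⌈n / q⌉₊ ≤ Real.exp (-n) := by
        calc (1 - q) ^ ⌈n / q⌉₊ ≤ Real.exp (-q) ^ ⌈n / q⌉₊ :=
              pow_le_pow_left₀ (sub_nonneg.mpr hq) (by linarith [Real.add_one_le_exp (-q)]) _
          _ = Real.exp (-(⌈n / q⌉₊ * q)) := by rw [← Real.exp_nat_mul]; ring_nf
          _ ≤ Real.exp (-n) := by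
            have := Nat.le_ceil ((n : ℝ) / q)
            rw [div_le_iff₀ hq0] at this
            exact Real.exp_le_exp.mpr (by linarith)
      have h2 : (#X : ℝ) ≤ 2 ^ n := by exact_mod_cast hX
      calc (1 - q) ^ ⌈n / q⌉₊ * (#X : ℝ) ≤ Real.exp (-n) * 2 ^ n := by gcongr
        _ < Real.exp (-n) * Real.exp 1 ^ n := by
          gcongr
          have := Real.exp_one_gt_d9
          linarith
        _ = 1 := by rw [← Real.exp_nat_mul, ← Real.exp_add]; simp
    have hzero : #{x ∈ X | ∀ y ∈ B, ¬ cov x y} = 0 := by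
      have : (#{x ∈ X | ∀ y ∈ B, ¬ cov x y} : ℝ) < 1 := hB.trans_lt hlt
      exact Nat.lt_one_iff.mp (by exact_mod_cast this)
    intro x hx
    by_contra! hcon
    exact (card_pos.mpr ⟨x, mem_filter.mpr ⟨hx, hcon⟩⟩).ne' hzero

/-- Every layer of subsets is covered, with prescribed intersection sizes, by few sets. -/
lemma exists_layer_cover {n k a b : ℕ} (hn : 0 < n) (hb : b ≤ k) (hka : k + a ≤ n) :
    ∃ T : Finset (Finset (Fin n)),
      (#T : ℝ) ≤ n / ((k.choose b * (n - k).choose a : ℕ) / (n.choose (a + b) : ℝ)) + 1 ∧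
      ∀ s : Finset (Fin n), #s = k → ∃ t ∈ T, #(t ∩ s) = b ∧ #(t \ s) = a := by
  classical
  have hpos : 0 < n.choose (a + b) := Nat.choose_pos (by omega)
  have hY : #(powersetCard (a + b) (univ : Finset (Fin n))) = n.choose (a + b) := by simp
  have hcount : ∀ s : Finset (Fin n), #s = k → k.choose b * (n - k).choose a ≤
      #{t ∈ powersetCard (a + b) (univ : Finset (Fin n)) | #(t ∩ s) = b ∧ #(t \ s) = a} := by
    intro s hs
    have hinter : ∀ u v : Finset (Fin n), u ⊆ s → v ⊆ sᶜ → (u ∪ v) ∩ s = u ∧ (u ∪ v) \ s = v := by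
      intro u v hu hv
      constructor <;> ext i <;> have h1 := @hu i <;> have h2 := @hv i <;>
        simp only [mem_compl, mem_inter, mem_union, Finset.mem_sdiff] at * <;> tauto
    have hc : #(powersetCard b s ×ˢ powersetCard a sᶜ) = k.choose b * (n - k).choose a := by
      rw [card_product, card_powersetCard, card_powersetCard, card_compl, hs, Fintype.card_fin]
    rw [← hc]
    refine card_le_card_of_injOn (fun z => z.1 ∪ z.2) ?_ ?_
    · rintro ⟨u, v⟩ hz
      simp only [coe_product, Set.mem_prod, mem_coe, mem_powersetCard] at hz
      obtain ⟨⟨hu, huc⟩, hv, hvc⟩ := hz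
      obtain ⟨h1, h2⟩ := hinter u v hu hv
      have hdisj : Disjoint u v :=
        disjoint_left.mpr fun i hi hi' => (mem_compl.mp (hv hi')) (hu hi)
      simp only [coe_filter, Set.mem_ofPred_eq, mem_powersetCard, subset_univ, true_and, h1, h2,
        huc, hvc, and_true, card_union_of_disjoint hdisj]
      omega
    · rintro ⟨u, v⟩ hz ⟨u', v'⟩ hz' heq
      simp only [coe_product, Set.mem_prod, mem_coe, mem_powersetCard] at hz hz'
      obtain ⟨h1, h2⟩ := hinter u v hz.1.1 hz.2.1
      obtain ⟨h1', h2'⟩ := hinter u' v' hz'.1.1 hz'.2.1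
      simp only at heq
      rw [heq] at h1 h2
      rw [Prod.mk.injEq]
      exact ⟨h1.symm.trans h1', h2.symm.trans h2'⟩
  have hk : k ≤ n := by omega
  -- Any one `k`-set serves to show that the covering fraction is at most `1`.
  obtain ⟨s₀, -, hs₀⟩ := exists_subset_card_eq (s := (univ : Finset (Fin n))) (n := k) (by simpa)
  have hle : k.choose b * (n - k).choose a ≤ n.choose (a + b) :=
    (hcount s₀ hs₀).trans (hY ▸ card_le_card (filter_subset _ _))
  have hnum : 0 < k.choose b * (n - k).choose a :=
    Nat.mul_pos (Nat.choose_pos hb) (Nat.choose_pos (by omega))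
  have hposR : (0 : ℝ) < n.choose (a + b) := by exact_mod_cast hpos
  obtain ⟨T, -, hT, hcov⟩ := exists_cover (powersetCard k (univ : Finset (Fin n)))
    (powersetCard (a + b) (univ : Finset (Fin n))) (card_pos.mp (hY ▸ hpos))
    (fun s t => #(t ∩ s) = b ∧ #(t \ s) = a)
    (q := (k.choose b * (n - k).choose a : ℕ) / (n.choose (a + b) : ℝ))
    (div_pos (by exact_mod_cast hnum) hposR)
    ((div_le_one hposR).mpr (by exact_mod_cast hle))
    (fun s hs => by
      rw [hY, div_mul_cancel₀ _ hposR.ne']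
      exact_mod_cast hcount s (mem_powersetCard.mp hs).2)
    hn (by simpa using Nat.choose_le_two_pow n k)
  exact ⟨T, hT, fun s hs => hcov s (mem_powersetCard.mpr ⟨subset_univ _, hs⟩)⟩

/-! ### Exponential growth of binomial coefficients -/

lemma tendsto_log_factorial_div :
    Tendsto (fun m : ℕ => Real.log m.factorial / m - Real.log m) atTop (𝓝 (-1)) := by
  have hcast : Tendsto (fun m : ℕ => (m : ℝ)) atTop atTop := tendsto_natCast_atTop_atTop
  have hlog : Tendsto (fun m : ℕ => Real.log (Stirling.stirlingSeq m)) atTop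
      (𝓝 (Real.log √Real.pi)) :=
    Stirling.tendsto_stirlingSeq_sqrt_pi.log (Real.sqrt_pos.mpr Real.pi_pos).ne'
  have h1 : Tendsto (fun m : ℕ => Real.log (Stirling.stirlingSeq m) / m) atTop (𝓝 0) :=
    hlog.div_atTop hcast
  have h2 : Tendsto (fun m : ℕ => Real.log m / m) atTop (𝓝 0) :=
    (Real.isLittleO_log_id_atTop.tendsto_div_nhds_zero).comp hcast
  have h3 : Tendsto (fun m : ℕ => 1 / 2 * Real.log 2 / (m : ℝ)) atTop (𝓝 0) :=
    tendsto_const_nhds.div_atTop hcast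
  have h4 := ((h1.add (h2.const_mul (1 / 2))).add h3).add (tendsto_const_nhds (x := (-1 : ℝ)))
  simp only [mul_zero, add_zero, zero_add] at h4
  refine h4.congr' ?_
  filter_upwards [eventually_gt_atTop 0] with m hm
  have hm' : (0 : ℝ) < m := by exact_mod_cast hm
  rw [Stirling.log_stirlingSeq_formula, Real.log_mul two_ne_zero hm'.ne',
    Real.log_div hm'.ne' (Real.exp_pos 1).ne', Real.log_exp]
  field_simp
  ring

/-- The subtracted `k log n` removes the divergence; in a binomial coefficient these terms cancel
because `m = j + (m - j)`. -/
lemma tendsto_log_factorial_scaled {k : ℕ → ℕ} {u : ℝ} (hu : 0 < u)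
    (hk : Tendsto (fun n => (k n : ℝ) / n) atTop (𝓝 u)) :
    Tendsto (fun n : ℕ => (Real.log (k n).factorial - k n * Real.log n) / n) atTop
      (𝓝 (u * Real.log u - u)) := by
  have hcast : Tendsto (fun m : ℕ => (m : ℝ)) atTop atTop := tendsto_natCast_atTop_atTop
  have hktop : Tendsto k atTop atTop := by
    rw [← tendsto_natCast_atTop_iff (R := ℝ)]
    refine (hk.pos_mul_atTop hu hcast).congr' ?_
    filter_upwards [eventually_gt_atTop 0] with n hn
    have : (n : ℝ) ≠ 0 := by exact_mod_cast hn.ne'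
    field_simp
  have h := (hk.mul (tendsto_log_factorial_div.comp hktop)).add (hk.mul (hk.log hu.ne'))
  rw [show u * -1 + u * Real.log u = u * Real.log u - u by ring] at h
  refine h.congr' ?_
  filter_upwards [eventually_gt_atTop 0, hktop.eventually_gt_atTop 0] with n hn hkn
  have hn' : (0 : ℝ) < n := by exact_mod_cast hn
  have hk' : (0 : ℝ) < k n := by exact_mod_cast hkn
  simp only [Function.comp_apply]
  rw [Real.log_div hk'.ne' hn'.ne']
  field_simp
  ring

/-- Exponential growth rate of binomial coefficients with proportional arguments. -/
lemma tendsto_log_choose_scaled {m j : ℕ → ℕ} {μ ι : ℝ} (hι : 0 < ι) (hιμ : ι < μ)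
    (hjm : ∀ᶠ n in atTop, j n ≤ m n)
    (hm : Tendsto (fun n => (m n : ℝ) / n) atTop (𝓝 μ))
    (hj : Tendsto (fun n => (j n : ℝ) / n) atTop (𝓝 ι)) :
    Tendsto (fun n : ℕ => Real.log ((m n).choose (j n)) / n) atTop
      (𝓝 (μ * Real.log μ - ι * Real.log ι - (μ - ι) * Real.log (μ - ι))) := by
  have hmj : Tendsto (fun n => ((m n - j n : ℕ) : ℝ) / n) atTop (𝓝 (μ - ι)) := by
    refine (hm.sub hj).congr' ?_
    filter_upwards [hjm] with n hn
    rw [Nat.cast_sub hn, sub_div]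
  have h := ((tendsto_log_factorial_scaled (hι.trans hιμ) hm).sub
    (tendsto_log_factorial_scaled hι hj)).sub
    (tendsto_log_factorial_scaled (sub_pos.mpr hιμ) hmj)
  rw [show μ * Real.log μ - μ - (ι * Real.log ι - ι) - ((μ - ι) * Real.log (μ - ι) - (μ - ι)) =
    μ * Real.log μ - ι * Real.log ι - (μ - ι) * Real.log (μ - ι) by ring] at h
  refine h.congr' ?_
  filter_upwards [hjm] with n hn
  have hf : ∀ l : ℕ, (l.factorial : ℝ) ≠ 0 := fun l => by exact_mod_cast l.factorial_ne_zero
  rw [Nat.cast_choose ℝ hn, Real.log_div (hf _) (mul_ne_zero (hf _) (hf _)),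
    Real.log_mul (hf _) (hf _), Nat.cast_sub hn]
  ring

lemma binEntropy_eq_neg (u : ℝ) :
    Real.binEntropy u = -(u * Real.log u) - (1 - u) * Real.log (1 - u) := by
  rw [Real.binEntropy, Real.log_inv, Real.log_inv]
  ring

lemma tendsto_log_choose_div {k : ℕ → ℕ} {u : ℝ} (h0 : 0 < u) (h1 : u < 1)
    (hk : Tendsto (fun n => (k n : ℝ) / n) atTop (𝓝 u)) (hkn : ∀ᶠ n in atTop, k n ≤ n) :
    Tendsto (fun n : ℕ => Real.log (n.choose (k n)) / n) atTop (𝓝 (Real.binEntropy u)) := by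
  have hid : Tendsto (fun n : ℕ => (n : ℝ) / n) atTop (𝓝 1) := by
    refine tendsto_const_nhds.congr' ?_
    filter_upwards [eventually_gt_atTop 0] with n hn
    rw [div_self (by exact_mod_cast hn.ne')]
  have := tendsto_log_choose_scaled (m := fun n => n) h0 h1 hkn hid hk
  rw [binEntropy_eq_neg]
  convert this using 2
  simp

/-! ### The rate function and auxiliary limits -/

lemma continuous_H₂ : Continuous H₂ := Real.binEntropy_continuous.div_const _

lemma continuous_hRate (d : ℝ) : Continuous (hRate d) := by
  unfold hRate
  exact continuous_H₂.sub (continuous_H₂.comp (by fun_prop))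

/-- The derivative is `H'(u) - H'(u + d - 1)`, negative because `H'` decreases and `u + d - 1 < u`.
-/
lemma hRate_strictAntiOn {d : ℝ} (h1 : d < 1) :
    StrictAntiOn (hRate d) (Set.Icc (1 - d) (1 - d / 2)) := by
  refine strictAntiOn_of_deriv_neg (convex_Icc _ _) (continuous_hRate d).continuousOn ?_
  intro u hu
  rw [interior_Icc] at hu
  obtain ⟨hu1, hu2⟩ := hu
  have hs0 : 0 < u + d - 1 := by linarith
  have hu0 : 0 < u := by linarith
  have hd0 : 0 < d := by linarith
  have hA : HasDerivAt H₂ ((Real.log (1 - u) - Real.log u) / Real.log 2) u :=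
    (Real.hasDerivAt_binEntropy hu0.ne' (by linarith)).div_const _
  have hB : HasDerivAt H₂
      ((Real.log (1 - (u + d - 1)) - Real.log (u + d - 1)) / Real.log 2) (u + d - 1) :=
    (Real.hasDerivAt_binEntropy hs0.ne' (by linarith)).div_const _
  have hC : HasDerivAt (fun x : ℝ => x + d - 1) 1 u := ((hasDerivAt_id u).add_const d).sub_const 1
  have hD := hA.sub (hB.comp u hC)
  rw [show deriv (hRate d) u = _ from hD.deriv, mul_one, ← sub_div]
  refine div_neg_of_neg_of_pos ?_ (Real.log_pos one_lt_two)
  have l1 : Real.log (1 - u) < Real.log (1 - (u + d - 1)) :=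
    Real.log_lt_log (by linarith) (by linarith)
  have l2 : Real.log (u + d - 1) < Real.log u := Real.log_lt_log hs0 (by linarith)
  linarith

lemma hRate_left (d : ℝ) : hRate d (1 - d) = H₂ (1 - d) := by
  simp [hRate, H₂]

lemma hRate_right (d : ℝ) : hRate d (1 - d / 2) = 0 := by
  unfold hRate H₂
  rw [Real.binEntropy_one_sub, show 1 - d / 2 + d - 1 = d / 2 by ring, sub_self]

lemma hRate_bijOn {d : ℝ} (h0 : 0 < d) (h1 : d < 1) :
    Set.BijOn (hRate d) (hDomain d) (Set.Ioc 0 (H₂ (1 - d))) := by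
  have hanti := hRate_strictAntiOn h1
  have hle : 1 - d ≤ 1 - d / 2 := by linarith
  refine ⟨?_, (hanti.mono Set.Ico_subset_Icc_self).injOn, ?_⟩
  · rintro u ⟨hu1, hu2⟩
    refine ⟨?_, ?_⟩
    · rw [← hRate_right d]
      exact hanti ⟨hu1, hu2.le⟩ ⟨hle, le_rfl⟩ hu2
    · rw [← hRate_left d]
      exact hanti.antitoneOn ⟨le_rfl, hle⟩ ⟨hu1, hu2.le⟩ hu1
  · rintro r ⟨hr0, hr1⟩
    obtain ⟨u, hu, rfl⟩ := intermediate_value_Icc' hle (continuous_hRate d).continuousOn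
      (show r ∈ Set.Icc (hRate d (1 - d / 2)) (hRate d (1 - d)) by
        rw [hRate_left, hRate_right]; exact ⟨hr0.le, hr1⟩)
    refine ⟨u, ⟨hu.1, lt_of_le_of_ne hu.2 ?_⟩, rfl⟩
    rintro rfl
    rw [hRate_right] at hr0
    exact lt_irrefl _ hr0

lemma continuousAt_klBits {u p : ℝ} (hu0 : 0 < u) (hu1 : u < 1) (hp0 : 0 < p) (hp1 : p < 1) :
    ContinuousAt (fun v => klBits v p) u := by
  unfold klBits Real.logb
  have h1 : u / p ≠ 0 := (div_pos hu0 hp0).ne'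
  have h2 : (1 - u) / (1 - p) ≠ 0 := (div_pos (sub_pos.mpr hu1) (sub_pos.mpr hp1)).ne'
  fun_prop (disch := assumption)

lemma eventually_add_one_le_exp {c : ℝ} (hc : 0 < c) :
    ∀ᶠ n : ℕ in atTop, (n : ℝ) + 1 ≤ Real.exp (n * c) := by
  filter_upwards [tendsto_natCast_atTop_atTop.eventually_ge_atTop (2 / c ^ 2)] with n hn
  rw [div_le_iff₀ (by positivity)] at hn
  have h := Real.quadratic_le_exp_of_nonneg (show 0 ≤ (n : ℝ) * c by positivity)
  nlinarith [mul_le_mul_of_nonneg_left hn (Nat.cast_nonneg (α := ℝ) n),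
    mul_nonneg (Nat.cast_nonneg (α := ℝ) n) hc.le]

lemma tendsto_floor_mul_natCast_div {v : ℝ} (hv : 0 ≤ v) :
    Tendsto (fun n : ℕ => (⌊v * n⌋₊ : ℝ) / n) atTop (𝓝 v) :=
  (tendsto_nat_floor_mul_div_atTop hv).comp tendsto_natCast_atTop_atTop

lemma tendsto_ceil_mul_natCast_div {v : ℝ} (hv : 0 ≤ v) :
    Tendsto (fun n : ℕ => (⌈v * n⌉₊ : ℝ) / n) atTop (𝓝 v) :=
  (tendsto_nat_ceil_mul_div_atTop hv).comp tendsto_natCast_atTop_atTop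

/-! ### Achievability -/

/-- The mutual information of the binary symmetric test channel with crossover probability `σ` and
input distribution `(1 - ω, ω)`, in terms of the joint probabilities. -/
lemma test_channel_information {ω σ u : ℝ} (hω0 : 0 < ω) (hω1 : ω < 1) (hσ0 : 0 < σ) (hσ1 : σ < 1)
    (hu : u = ω * (1 - σ) + (1 - ω) * σ) :
    (u * Real.log u - ω * (1 - σ) * Real.log (ω * (1 - σ)) -
        (u - ω * (1 - σ)) * Real.log (u - ω * (1 - σ))) +
      ((1 - u) * Real.log (1 - u) - ω * σ * Real.log (ω * σ) -
        (1 - u - ω * σ) * Real.log (1 - u - ω * σ)) - Real.binEntropy ω =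
      Real.binEntropy σ - Real.binEntropy u := by
  have h1 : u - ω * (1 - σ) = (1 - ω) * σ := by rw [hu]; ring
  have h2 : 1 - u - ω * σ = (1 - ω) * (1 - σ) := by rw [hu]; ring
  have hω : 0 < 1 - ω := by linarith
  have hσ : 0 < 1 - σ := by linarith
  rw [h1, h2, binEntropy_eq_neg, binEntropy_eq_neg, binEntropy_eq_neg,
    Real.log_mul hω0.ne' hσ.ne', Real.log_mul hω.ne' hσ0.ne', Real.log_mul hω0.ne' hσ0.ne',
    Real.log_mul hω.ne' hσ.ne']
  ring

lemma hRate_mul_log_two (d u : ℝ) :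
    hRate d u * Real.log 2 = Real.binEntropy u - Real.binEntropy (u + d - 1) := by
  have := (Real.log_pos one_lt_two).ne'
  unfold hRate H₂
  field_simp

/-- At any rate above `h(u)`, all error patterns with slightly more than `u n` correct letters can be
covered. -/
lemma eventually_exists_cover {d u r : ℝ} (h1 : d < 1) (hu1 : 1 - d < u)
    (hu2 : u < 1 - d / 2) (hr : hRate d u < r) :
    ∀ᶠ n : ℕ in atTop, ∃ B : Finset (Fin n → Fin 2), (#B : ℝ) ≤ (2 : ℝ) ^ ((n : ℝ) * r) ∧
      ∀ s : Finset (Fin n), u * n + 1 ≤ #s →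
        ∃ y ∈ B, distortion (indicatorPattern s) y ≤ n * d := by
  have hd0 : 0 < d := by linarith
  have hrate0 : 0 < hRate d u := ((hRate_bijOn hd0 h1).mapsTo ⟨hu1.le, hu2⟩).1
  -- Test channel: `t` has density `ω` and `s` arises by flipping letters with probability `σ`. This
  -- `ω` gives `s` density `u` and the pair distortion `1 - ω (1 - 2σ) = d` per letter.
  obtain ⟨σ, hσ⟩ : ∃ σ, σ = u + d - 1 := ⟨_, rfl⟩
  obtain ⟨ω, hω⟩ : ∃ ω, ω = (1 - d) / (1 - 2 * σ) := ⟨_, rfl⟩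
  have hσ0 : 0 < σ := by linarith
  have hσd : σ < d / 2 := by linarith
  have hden : 0 < 1 - 2 * σ := by linarith
  have hω0 : 0 < ω := hω ▸ div_pos (by linarith) hden
  have hω1 : ω < 1 := by rw [hω, div_lt_one hden]; linarith
  have hωσ : ω * (1 - 2 * σ) = 1 - d := by rw [hω, div_mul_cancel₀ _ hden.ne']
  have hu : u = ω * (1 - σ) + (1 - ω) * σ := by linear_combination -hσ - hωσ
  have hα : 0 < ω * σ := by positivity
  have hβ : 0 < ω * (1 - σ) := mul_pos hω0 (by linarith)
  have hγ : 0 < (1 - ω) * σ := mul_pos (by linarith) hσ0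
  have hθ : 0 < (1 - ω) * (1 - σ) := mul_pos (by linarith) (by linarith)
  -- `a = #(t \ s)` is rounded down and `b = #(t ∩ s)` up, so the distortion `n - b + a` never
  -- exceeds `n d`. Rounding brings `k = #s` to at most `u n + 1`.
  let a : ℕ → ℕ := fun n => ⌊ω * σ * n⌋₊
  let b : ℕ → ℕ := fun n => ⌈ω * (1 - σ) * n⌉₊
  let k : ℕ → ℕ := fun n => b n + ⌊(1 - ω) * σ * n⌋₊
  have ha : Tendsto (fun n => (a n : ℝ) / n) atTop (𝓝 (ω * σ)) :=
    tendsto_floor_mul_natCast_div hα.le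
  have hb : Tendsto (fun n => (b n : ℝ) / n) atTop (𝓝 (ω * (1 - σ))) :=
    tendsto_ceil_mul_natCast_div hβ.le
  have hk : Tendsto (fun n => (k n : ℝ) / n) atTop (𝓝 u) := by
    rw [hu]
    refine (hb.add (tendsto_floor_mul_natCast_div hγ.le)).congr fun n => ?_
    simp only [k, Nat.cast_add, add_div]
  have hab : Tendsto (fun n => ((a n + b n : ℕ) : ℝ) / n) atTop (𝓝 ω) := by
    have := ha.add hb
    rw [show ω * σ + ω * (1 - σ) = ω by ring] at this
    refine this.congr fun n => ?_
    rw [Nat.cast_add, add_div]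
  have ha_le : ∀ n, (a n : ℝ) ≤ ω * σ * n := fun n => Nat.floor_le (by positivity)
  have hb_ge : ∀ n, ω * (1 - σ) * n ≤ (b n : ℝ) := fun n => Nat.le_ceil _
  have hk_le : ∀ n, (k n : ℝ) ≤ u * n + 1 := by
    intro n
    have e1 : (b n : ℝ) < ω * (1 - σ) * n + 1 := Nat.ceil_lt_add_one (by positivity)
    have e2 : (⌊(1 - ω) * σ * n⌋₊ : ℝ) ≤ (1 - ω) * σ * n := Nat.floor_le (by positivity)
    simp only [k, Nat.cast_add]
    rw [hu]
    linarith
  have hbk : ∀ n, b n ≤ k n := fun n => Nat.le_add_right _ _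
  have hkan : ∀ᶠ n in atTop, k n + a n ≤ n := by
    filter_upwards [tendsto_natCast_atTop_atTop.eventually_ge_atTop (1 / ((1 - ω) * (1 - σ)))]
      with n hn
    rw [div_le_iff₀ hθ] at hn
    have e1 := hk_le n
    have e2 := ha_le n
    rw [hu] at e1
    have : (k n : ℝ) + a n ≤ n := by nlinarith
    exact_mod_cast this
  have hnk : Tendsto (fun n => ((n - k n : ℕ) : ℝ) / n) atTop (𝓝 (1 - u)) := by
    refine (hk.const_sub 1).congr' ?_
    filter_upwards [hkan, eventually_gt_atTop 0] with n hn hn0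
    have : (n : ℝ) ≠ 0 := by exact_mod_cast hn0.ne'
    rw [Nat.cast_sub (by omega), sub_div, div_self this]
  have hlim := ((tendsto_log_choose_scaled (m := k) (j := b) hβ (by linarith)
      (Eventually.of_forall hbk) hk hb).add
    (tendsto_log_choose_scaled (m := fun n => n - k n) (j := a) hα (by linarith)
      (hkan.mono fun n hn => by omega) hnk ha)).sub
    (tendsto_log_choose_div (k := fun n => a n + b n) hω0 hω1 hab
      (hkan.mono fun n hn => by have := hbk n; omega))
  rw [test_channel_information hω0 hω1 hσ0 (by linarith) hu] at hlim
  -- The gap between `ρ` and `r` absorbs the factor `n + 1` lost in greedy covering.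
  obtain ⟨ρ, hρ1, hρ2⟩ := exists_between hr
  have hl2 := Real.log_pos one_lt_two
  have hE : -(ρ * Real.log 2) < Real.binEntropy σ - Real.binEntropy u := by
    have := hRate_mul_log_two d u
    rw [← hσ] at this
    nlinarith [mul_lt_mul_of_pos_right hρ1 hl2]
  filter_upwards [hlim.eventually_const_lt hE, hkan, eventually_gt_atTop 0,
    eventually_add_one_le_exp (mul_pos (sub_pos.mpr hρ2) hl2)] with n hn hkn hn0 hexp
  obtain ⟨T, hT, hcov⟩ := exists_layer_cover hn0 (hbk n) hkn
  have hn0' : (0 : ℝ) < n := by exact_mod_cast hn0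
  refine ⟨T.image indicatorPattern, ?_, ?_⟩
  · have c1 : (0 : ℝ) < (k n).choose (b n) := by exact_mod_cast Nat.choose_pos (hbk n)
    have c2 : (0 : ℝ) < (n - k n).choose (a n) := by
      exact_mod_cast Nat.choose_pos (by omega)
    have c3 : (0 : ℝ) < n.choose (a n + b n) := by
      have := hbk n
      exact_mod_cast Nat.choose_pos (by omega)
    rw [Nat.cast_mul] at hT
    set q : ℝ := ((k n).choose (b n) : ℝ) * (n - k n).choose (a n) / n.choose (a n + b n) with hq
    have hq0 : 0 < q := div_pos (mul_pos c1 c2) c3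
    have hlogq : -(n * (ρ * Real.log 2)) ≤ Real.log q := by
      rw [hq, Real.log_div (mul_pos c1 c2).ne' c3.ne', Real.log_mul c1.ne' c2.ne']
      rw [← add_div, ← sub_div, lt_div_iff₀ hn0'] at hn
      linarith
    have hqexp : Real.exp (-(n * (ρ * Real.log 2))) ≤ q := (Real.le_log_iff_exp_le hq0).mp hlogq
    have hone : 1 ≤ Real.exp (n * (ρ * Real.log 2)) := by
      rw [Real.one_le_exp_iff]
      have := hrate0.trans hρ1
      positivity
    calc (#(T.image indicatorPattern) : ℝ) ≤ #T := by exact_mod_cast card_image_le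
      _ ≤ n / q + 1 := hT
      _ ≤ n / Real.exp (-(n * (ρ * Real.log 2))) + 1 := by gcongr
      _ = n * Real.exp (n * (ρ * Real.log 2)) + 1 := by rw [Real.exp_neg, div_inv_eq_mul]
      _ ≤ ((n : ℝ) + 1) * Real.exp (n * (ρ * Real.log 2)) := by linarith
      _ ≤ Real.exp (n * ((r - ρ) * Real.log 2)) * Real.exp (n * (ρ * Real.log 2)) := by gcongr
      _ = (2 : ℝ) ^ ((n : ℝ) * r) := by rw [← Real.exp_add, two_rpow_eq_exp]; ring_nf
  · intro s hs
    obtain ⟨s', hs's, hs'⟩ := exists_subset_card_eq (s := s) (n := k n)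
      (by exact_mod_cast (hk_le n).trans hs)
    obtain ⟨t, ht, ht1, ht2⟩ := hcov s' hs'
    refine ⟨_, mem_image_of_mem _ ht, (distortion_anti hs's _).trans ?_⟩
    rw [distortion_indicatorPattern, ht1, ht2]
    have e1 := ha_le n
    have e2 := hb_ge n
    have e3 : ω * (1 - 2 * σ) * n = (1 - d) * n := by rw [hωσ]
    linarith

lemma klBits_self {p : ℝ} (hp0 : 0 < p) (hp1 : p < 1) : klBits p p = 0 := by
  have : 1 - p ≠ 0 := by linarith
  simp [klBits, div_self hp0.ne', div_self this]

lemma two_rpow_neg_mul_klBits (n u p : ℝ) :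
    (2 : ℝ) ^ (-(n * klBits u p)) = Real.exp (-(n * klNats u p)) := by
  have := (Real.log_pos one_lt_two).ne'
  rw [two_rpow_eq_exp, klBits_eq]
  congr 1
  field_simp

lemma missProb_le_one {n : ℕ} {p : ℝ} (hp0 : 0 ≤ p) (hp1 : p ≤ 1) (D : ℝ)
    (B : Finset (Fin n → Fin 2)) : missProb p D B ≤ 1 :=
  (missProb_le_sum hp0 hp1 (S := univ) fun s hs => absurd (mem_univ s) hs).trans
    (sum_subsetProb n p).le

lemma eventually_exists_missProb_le {d u r p ε : ℝ} (h1 : d < 1)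
    (hu : u ∈ hDomain d) (hr : hRate d u = r) (hup : u ≤ p) (hp1 : p < 1) (hε : 0 < ε) :
    ∀ᶠ n : ℕ in atTop, ∃ B : Finset (Fin n → Fin 2), (#B : ℝ) ≤ (2 : ℝ) ^ ((n : ℝ) * r) ∧
      missProb p (n * d) B ≤ (2 : ℝ) ^ (-((n : ℝ) * (klBits u p - ε))) := by
  obtain ⟨hu1, hu2⟩ := hu
  have hu0 : 0 < u := by linarith
  have hp0 : 0 < p := hu0.trans_le hup
  -- At `u = p` the claimed exponent is not positive, so no attempts are needed.
  rcases hup.eq_or_lt with rfl | hlt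
  · refine Eventually.of_forall fun n => ⟨∅, by simp; positivity, ?_⟩
    refine (missProb_le_one hp0.le hp1.le _ _).trans (Real.one_le_rpow one_le_two ?_)
    rw [klBits_self hp0 hp1, zero_sub, mul_neg, neg_neg]
    positivity
  have hcont := (continuousAt_klBits hu0 (hlt.trans hp1) hp0 hp1).eventually_const_lt
    (show klBits u p - ε < klBits u p by linarith)
  obtain ⟨w, hw⟩ := ((hcont.filter_mono (nhdsWithin_le_nhds (s := Set.Ioi u))).and
    (Ioo_mem_nhdsGT (lt_min hlt hu2))).exists
  obtain ⟨hwkl, huw, hwmin⟩ := hw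
  have hwp : w < p := hwmin.trans_le (min_le_left _ _)
  have hw2 : w < 1 - d / 2 := hwmin.trans_le (min_le_right _ _)
  -- Layers are covered from `v n + 1` on and the tail is cut at `w n`; `v < w` absorbs the `1`, and
  -- `u < v` makes the rate strictly sufficient.
  obtain ⟨v, huv, hvw⟩ := exists_between huw
  have hrate : hRate d v < r := hr ▸ hRate_strictAntiOn h1 ⟨hu1, hu2.le⟩
    ⟨(hu1.trans_lt huv).le, (hvw.trans hw2).le⟩ huv
  filter_upwards [eventually_exists_cover h1 (hu1.trans_lt huv) (hvw.trans hw2) hrate,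
    tendsto_natCast_atTop_atTop.eventually_ge_atTop (1 / (w - v))] with n hB hn
  obtain ⟨B, hBcard, hcov⟩ := hB
  rw [div_le_iff₀ (by linarith)] at hn
  refine ⟨B, hBcard, ?_⟩
  have hmiss : missProb p (n * d) B ≤
      ∑ s : Finset (Fin n) with (#s : ℝ) ≤ w * n, p ^ #s * (1 - p) ^ (n - #s) := by
    refine missProb_le_sum hp0.le hp1.le fun s hs => hcov s ?_
    rw [mem_filter, not_and, not_le] at hs
    linarith [hs (mem_univ _)]
  refine (hmiss.trans (lowerTail_le (hu0.trans huw) hwp.le hp1)).trans ?_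
  rw [← two_rpow_neg_mul_klBits]
  refine Real.rpow_le_rpow_of_exponent_le one_le_two (neg_le_neg ?_)
  gcongr

/-- One family must serve every `ε`: for each `n` take a minimizer of the failure probability among
all sets of allowed size. -/
lemma exists_missProb_le {d u r p : ℝ} (h1 : d < 1)
    (hu : u ∈ hDomain d) (hr : hRate d u = r) (hup : u ≤ p) (hp1 : p < 1) :
    ∃ B : ∀ n : ℕ, Finset (Fin n → Fin 2), HasRate r B ∧ ∀ ε : ℝ, 0 < ε → ∀ᶠ n : ℕ in atTop,
      missProb p (n * d) (B n) ≤ (2 : ℝ) ^ (-((n : ℝ) * (klBits u p - ε))) := by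
  classical
  have hmin : ∀ n : ℕ, ∃ B : Finset (Fin n → Fin 2), (#B : ℝ) ≤ (2 : ℝ) ^ ((n : ℝ) * r) ∧
      ∀ B' : Finset (Fin n → Fin 2), (#B' : ℝ) ≤ (2 : ℝ) ^ ((n : ℝ) * r) →
        missProb p (n * d) B ≤ missProb p (n * d) B' := by
    intro n
    obtain ⟨B, hB, hBmin⟩ := exists_min_image
      ({B | (#B : ℝ) ≤ (2 : ℝ) ^ ((n : ℝ) * r)} : Finset (Finset (Fin n → Fin 2)))
      (missProb p (n * d)) ⟨∅, by simp; positivity⟩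
    exact ⟨B, (mem_filter.mp hB).2, fun B' hB' => hBmin B' (mem_filter.mpr ⟨mem_univ _, hB'⟩)⟩
  choose B hB hBmin using hmin
  refine ⟨B, hB, fun ε hε => ?_⟩
  filter_upwards [eventually_exists_missProb_le h1 hu hr hup hp1 hε] with n hn
  obtain ⟨B', hB', hle⟩ := hn
  exact (hBmin n B' hB').trans hle

/-! ### Converse -/

/-- If `v` lies below the threshold of the rate `r`, at least half of the patterns with `⌊v n⌋`
correct letters are not covered. -/
lemma eventually_half_uncovered {d v r : ℝ} (h1 : d < 1) (hv0 : 0 < v) (hv1 : v < 1)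
    (hv : v < 1 - d ∨ (1 - d < v ∧ v < 1 - d / 2 ∧ r < hRate d v))
    {B : ∀ n : ℕ, Finset (Fin n → Fin 2)} (hB : HasRate r B) :
    ∀ᶠ n : ℕ in atTop, ∃ S ⊆ powersetCard ⌊v * n⌋₊ (univ : Finset (Fin n)),
      (n.choose ⌊v * n⌋₊ : ℝ) / 2 ≤ #S ∧
      ∀ s ∈ S, ∀ y ∈ B n, n * d < distortion (indicatorPattern s) y := by
  classical
  have hfloor : ∀ n : ℕ, (⌊v * n⌋₊ : ℝ) ≤ v * n := fun n => Nat.floor_le (by positivity)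
  have hdist : ∀ n : ℕ, ∀ s ∈ powersetCard ⌊v * n⌋₊ (univ : Finset (Fin n)), ∀ y,
      (1 - v) * n + #(symmDiff s (patternSupport y)) ≤ distortion (indicatorPattern s) y := by
    intro n s hs y
    conv_rhs => rw [← indicatorPattern_patternSupport y]
    rw [distortion_eq_symmDiff, (mem_powersetCard.mp hs).2]
    linarith [hfloor n]
  rcases hv with hv | ⟨hvl, hvr, hrate⟩
  -- Below `1 - d` the wrong letters alone cost more than `n d`, whatever is erased.
  · filter_upwards [eventually_gt_atTop 0] with n hn
    have hn' : (0 : ℝ) < n := by exact_mod_cast hn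
    refine ⟨_, subset_rfl, ?_, fun s hs y _ => lt_of_lt_of_le ?_ (hdist n s hs y)⟩
    · rw [card_powersetCard, card_univ, Fintype.card_fin]
      exact half_le_self (Nat.cast_nonneg _)
    · have : (0 : ℝ) ≤ #(symmDiff s (patternSupport y)) := Nat.cast_nonneg _
      nlinarith
  · have hl2 := Real.log_pos one_lt_two
    have hkn : ∀ n : ℕ, ⌊v * n⌋₊ ≤ n := fun n => by
      have h := hfloor n
      have : (⌊v * n⌋₊ : ℝ) ≤ n := h.trans (mul_le_of_le_one_left (Nat.cast_nonneg _) hv1.le)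
      exact_mod_cast this
    have hlim := tendsto_log_choose_div hv0 hv1 (tendsto_floor_mul_natCast_div hv0.le)
      (Eventually.of_forall hkn)
    have hgap : r * Real.log 2 + Real.binEntropy (v + d - 1) < Real.binEntropy v := by
      have := hRate_mul_log_two d v
      nlinarith [mul_lt_mul_of_pos_right hrate hl2]
    obtain ⟨τ, hτ1, hτ2⟩ := exists_between hgap
    filter_upwards [hlim.eventually_const_lt hτ2, eventually_gt_atTop 0,
      eventually_add_one_le_exp (sub_pos.mpr hτ1)] with n hn hn0 hexp
    have hn0' : (0 : ℝ) < n := by exact_mod_cast hn0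
    have hc : (0 : ℝ) < n.choose ⌊v * n⌋₊ := by exact_mod_cast Nat.choose_pos (hkn n)
    have hchoose : Real.exp (n * τ) ≤ n.choose ⌊v * n⌋₊ := by
      rw [← Real.le_log_iff_exp_le hc]
      rw [lt_div_iff₀ hn0'] at hn
      linarith
    set P := powersetCard ⌊v * n⌋₊ (univ : Finset (Fin n)) with hP
    have hPcard : #P = n.choose ⌊v * n⌋₊ := by simp [hP]
    let good : Finset (Fin n) → Prop := fun s =>
      ∀ y ∈ B n, n * d < distortion (indicatorPattern s) y
    refine ⟨{s ∈ P | good s}, filter_subset _ _, ?_, fun s hs => (mem_filter.mp hs).2⟩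
    -- Union bound over balls of radius `(v + d - 1) n`, which is below `n / 2` because `v < 1 - d /
    -- 2` and `d < 1`.
    have hbad : (#{s ∈ P | ¬ good s} : ℝ) ≤
        Real.exp (n * (r * Real.log 2 + Real.binEntropy (v + d - 1))) := by
      have hsub : {s ∈ P | ¬ good s} ⊆ (B n).biUnion fun y =>
          {s : Finset (Fin n) | (#(symmDiff s (patternSupport y)) : ℝ) ≤ (v + d - 1) * n} := by
        intro s hs
        obtain ⟨hsP, hs⟩ := mem_filter.mp hs
        simp only [good, not_forall, not_lt] at hs
        obtain ⟨y, hy, hle⟩ := hs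
        rw [mem_biUnion]
        refine ⟨y, hy, mem_filter.mpr ⟨mem_univ _, ?_⟩⟩
        linarith [hdist n s hsP y]
      calc (#{s ∈ P | ¬ good s} : ℝ) ≤ ∑ y ∈ B n, (#{s : Finset (Fin n) |
            (#(symmDiff s (patternSupport y)) : ℝ) ≤ (v + d - 1) * n} : ℝ) := by
              exact_mod_cast (card_le_card hsub).trans card_biUnion_le
        _ ≤ ∑ y ∈ B n, Real.exp (n * Real.binEntropy (v + d - 1)) :=
          sum_le_sum fun y _ => card_hammingBall_le (by linarith) (by linarith) _
        _ = #(B n) * Real.exp (n * Real.binEntropy (v + d - 1)) := by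
          rw [sum_const, nsmul_eq_mul]
        _ ≤ (2 : ℝ) ^ ((n : ℝ) * r) * Real.exp (n * Real.binEntropy (v + d - 1)) := by
          gcongr
          exact hB n
        _ = _ := by rw [two_rpow_eq_exp, ← Real.exp_add]; ring_nf
    have htwo : 2 * Real.exp (n * (r * Real.log 2 + Real.binEntropy (v + d - 1))) ≤
        n.choose ⌊v * n⌋₊ := by
      have h2 : (2 : ℝ) ≤ (n : ℝ) + 1 := by
        have : (1 : ℝ) ≤ n := by exact_mod_cast hn0
        linarith
      calc _ ≤ Real.exp (n * (τ - (r * Real.log 2 + Real.binEntropy (v + d - 1)))) *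
            Real.exp (n * (r * Real.log 2 + Real.binEntropy (v + d - 1))) := by
              gcongr
              exact h2.trans hexp
        _ = Real.exp (n * τ) := by rw [← Real.exp_add]; ring_nf
        _ ≤ _ := hchoose
    have hsplit : (#{s ∈ P | good s} : ℝ) + #{s ∈ P | ¬ good s} = n.choose ⌊v * n⌋₊ := by
      rw [← hPcard]
      exact_mod_cast card_filter_add_card_filter_not (s := P) good
    linarith

/-- All sets in the layer `⌊v n⌋` are equally likely, so half of it has exponent `H(v) + v log p +
(1 - v) log (1 - p) = -D(v‖p)`. -/
lemma eventually_le_missProb_of_lt {d v r p ε : ℝ} (h1 : d < 1) (hv0 : 0 < v) (hv1 : v < 1)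
    (hv : v < 1 - d ∨ (1 - d < v ∧ v < 1 - d / 2 ∧ r < hRate d v))
    (hp0 : 0 < p) (hp1 : p < 1) (hε : 0 < ε)
    {B : ∀ n : ℕ, Finset (Fin n → Fin 2)} (hB : HasRate r B) :
    ∀ᶠ n : ℕ in atTop,
      (2 : ℝ) ^ (-((n : ℝ) * (klBits v p + ε))) ≤ missProb p (n * d) (B n) := by
  have hl2 := Real.log_pos one_lt_two
  have hq0 : 0 < 1 - p := by linarith
  have hw0 : 0 < 1 - v := by linarith
  have hkn : ∀ n : ℕ, ⌊v * n⌋₊ ≤ n := fun n => by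
    have : (⌊v * n⌋₊ : ℝ) ≤ n := (Nat.floor_le (by positivity)).trans
      (mul_le_of_le_one_left (Nat.cast_nonneg _) hv1.le)
    exact_mod_cast this
  have hk := tendsto_floor_mul_natCast_div hv0.le
  have hlim := (((tendsto_log_choose_div hv0 hv1 hk (Eventually.of_forall hkn)).add
    (hk.mul_const (Real.log p))).add ((hk.const_sub 1).mul_const (Real.log (1 - p)))).sub
    (tendsto_const_nhds (x := Real.log 2).div_atTop tendsto_natCast_atTop_atTop)
  have hval : Real.binEntropy v + v * Real.log p + (1 - v) * Real.log (1 - p) - 0 =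
      -klNats v p := by
    rw [klNats, binEntropy_eq_neg, Real.log_div hv0.ne' hp0.ne', Real.log_div hw0.ne' hq0.ne']
    ring
  rw [hval] at hlim
  have hlt : -(klNats v p + ε * Real.log 2) < -klNats v p := by
    have := mul_pos hε hl2
    linarith
  filter_upwards [hlim.eventually_const_lt hlt, eventually_gt_atTop 0,
    eventually_half_uncovered h1 hv0 hv1 hv hB] with n hn hn0 hS
  obtain ⟨S, hSP, hScard, hSunc⟩ := hS
  have hn0' : (0 : ℝ) < n := by exact_mod_cast hn0
  have hc : (0 : ℝ) < n.choose ⌊v * n⌋₊ := by exact_mod_cast Nat.choose_pos (hkn n)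
  refine le_trans ?_ (sum_le_missProb hp0.le hp1.le hSunc)
  have hsum : ∑ s ∈ S, p ^ #s * (1 - p) ^ (n - #s) =
      #S * (p ^ ⌊v * n⌋₊ * (1 - p) ^ (n - ⌊v * n⌋₊)) := by
    rw [← nsmul_eq_mul, ← sum_const]
    refine sum_congr rfl fun s hs => ?_
    rw [(mem_powersetCard.mp (hSP hs)).2]
  rw [hsum]
  refine le_trans ?_ (mul_le_mul_of_nonneg_right hScard (by positivity))
  rw [two_rpow_eq_exp, ← Real.le_log_iff_exp_le (by positivity),
    Real.log_mul (by positivity) (by positivity), Real.log_mul (by positivity) (by positivity),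
    Real.log_div hc.ne' two_ne_zero, Real.log_pow, Real.log_pow, Nat.cast_sub (hkn n)]
  have hn' := mul_lt_mul_of_pos_right hn hn0'
  have e1 : klBits v p * Real.log 2 = klNats v p := by
    rw [klBits_eq, div_mul_cancel₀ _ hl2.ne']
  have e2 : (Real.log (n.choose ⌊v * n⌋₊) / n + (⌊v * n⌋₊ : ℝ) / n * Real.log p +
      (1 - (⌊v * n⌋₊ : ℝ) / n) * Real.log (1 - p) - Real.log 2 / n) * n =
      Real.log (n.choose ⌊v * n⌋₊) - Real.log 2 + (⌊v * n⌋₊ * Real.log p +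
        (n - ⌊v * n⌋₊) * Real.log (1 - p)) := by
    field_simp
    ring
  rw [e2] at hn'
  refine le_trans (le_of_eq ?_) hn'.le
  rw [← e1]
  ring

lemma eventually_le_missProb {d u r p ε : ℝ} (h1 : d < 1)
    (hu : u ∈ hDomain d) (hr : hRate d u = r) (hp0 : 0 < p) (hp1 : p < 1) (hε : 0 < ε)
    {B : ∀ n : ℕ, Finset (Fin n → Fin 2)} (hB : HasRate r B) :
    ∀ᶠ n : ℕ in atTop,
      (2 : ℝ) ^ (-((n : ℝ) * (klBits u p + ε))) ≤ missProb p (n * d) (B n) := by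
  obtain ⟨hu1, hu2⟩ := hu
  have hu0 : 0 < u := by linarith
  have hu_lt : u < 1 := by linarith
  have hcont := (continuousAt_klBits hu0 hu_lt hp0 hp1).eventually_lt_const
    (show klBits u p < klBits u p + ε / 2 by linarith)
  obtain ⟨v, hvkl, hv0, hvu, hv⟩ : ∃ v, klBits v p < klBits u p + ε / 2 ∧ 0 < v ∧ v < u ∧
      (v < 1 - d ∨ (1 - d < v ∧ v < 1 - d / 2 ∧ r < hRate d v)) := by
    -- At the endpoint `u = 1 - d` every `v < u` leaves the domain of `h`; there the whole layer is
    -- uncovered.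
    rcases hu1.eq_or_lt with rfl | hlt
    · obtain ⟨v, hv, hv0, hvu⟩ := ((hcont.filter_mono (nhdsWithin_le_nhds (s := Set.Iio (1 - d)))).and
        (Ioo_mem_nhdsLT hu0)).exists
      exact ⟨v, hv, hv0, hvu, Or.inl hvu⟩
    · obtain ⟨v, hv, hv0, hvu⟩ := ((hcont.filter_mono (nhdsWithin_le_nhds (s := Set.Iio u))).and
        (Ioo_mem_nhdsLT hlt)).exists
      refine ⟨v, hv, by linarith, hvu, Or.inr ⟨hv0, hvu.trans hu2, ?_⟩⟩
      rw [← hr]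
      exact hRate_strictAntiOn h1 ⟨hv0.le, (hvu.trans hu2).le⟩ ⟨hlt.le, hu2.le⟩ hvu
  filter_upwards [eventually_le_missProb_of_lt h1 hv0 (hvu.trans hu_lt) hv hp0 hp1
    (half_pos hε) hB] with n hn
  refine le_trans (Real.rpow_le_rpow_of_exponent_le one_le_two (neg_le_neg ?_)) hn
  exact mul_le_mul_of_nonneg_left (by linarith) (Nat.cast_nonneg n)

end

theorem theorem1 (𝔽 : ℕ → Type*) [∀ n, Field (𝔽 n)] [∀ n, Fintype (𝔽 n)]
    [∀ n, DecidableEq (𝔽 n)] (p : ℝ) (hp1 : p < 1)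
    (hp : ∀ n, (1 - p) / ((Fintype.card (𝔽 n) : ℝ) - 1) < p)
    (N : ℕ) (R D : ℝ) (hD : D ∈ Set.Ioo (0 : ℝ) N)
    (hR : R ∈ Set.Ioc (0 : ℝ) (N * H₂ (1 - D / N))) :
    Set.BijOn (hRate (D / N)) (hDomain (D / N)) (Set.Ioc 0 (H₂ (1 - D / N))) ∧
    (hInv (D / N) (R / N) ≤ p →
      IsGreatest {F : ℝ | ExponentAchievable 𝔽 p N R D F}
        (N * klBits (hInv (D / N) (R / N)) p) ∧
      ExponentConverse 𝔽 p N R D (N * klBits (hInv (D / N) (R / N)) p)) := by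
  have hN : (0 : ℝ) < N := hD.1.trans hD.2
  have hd0 : 0 < D / N := div_pos hD.1 hN
  have hd1 : D / N < 1 := (div_lt_one hN).mpr hD.2
  have hp0 : 0 < p := by
    have hcard : (1 : ℝ) < Fintype.card (𝔽 0) := by exact_mod_cast Fintype.one_lt_card
    exact (div_pos (sub_pos.mpr hp1) (sub_pos.mpr hcard)).trans (hp 0)
  have hbij := hRate_bijOn hd0 hd1
  refine ⟨hbij, fun hup => ?_⟩
  have hmem : R / N ∈ hRate (D / N) '' hDomain (D / N) :=
    hbij.surjOn ⟨div_pos hR.1 hN, (div_le_iff₀' hN).mpr hR.2⟩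
  have hu : hInv (D / N) (R / N) ∈ hDomain (D / N) := Function.invFunOn_mem hmem
  have hr : hRate (D / N) (hInv (D / N) (R / N)) = R / N := Function.invFunOn_eq hmem
  have hF : N * klBits (hInv (D / N) (R / N)) p / N = klBits (hInv (D / N) (R / N)) p :=
    mul_div_cancel_left₀ _ hN.ne'
  have hconv : ExponentConverse 𝔽 p N R D (N * klBits (hInv (D / N) (R / N)) p) := by
    intro B hB ε hε
    filter_upwards [eventually_le_missProb hd1 hu hr hp0 hp1 hε hB] with n hn c
    rw [errorProb_eq_missProb, hF]
    exact hn
  refine ⟨⟨?_, ?_⟩, hconv⟩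
  · obtain ⟨B, hB, hle⟩ := exists_missProb_le hd1 hu hr hup hp1
    refine ⟨B, hB, fun ε hε => ?_⟩
    filter_upwards [hle ε hε] with n hn c
    rw [errorProb_eq_missProb, hF]
    exact hn
  · rintro F ⟨B, hB, hle⟩
    by_contra! hlt
    have hlt' : klBits (hInv (D / N) (R / N)) p < F / N := by
      rw [lt_div_iff₀' hN]
      exact hlt
    -- With a third of the gap, the two bounds would force the gap to be at most two thirds of
    -- itself.
    have hε : 0 < (F / N - klBits (hInv (D / N) (R / N)) p) / 3 := by linarith
    obtain ⟨n, ⟨hn1, hn2⟩, hn0⟩ :=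
      (((hle _ hε).and (hconv B hB _ hε)).and (eventually_gt_atTop 0)).exists
    have h := (hn2 fun _ => 0).trans (hn1 fun _ => 0)
    rw [Real.rpow_le_rpow_left_iff one_lt_two, neg_le_neg_iff, hF] at h
    have hn0' : (0 : ℝ) < n := by exact_mod_cast hn0
    have := le_of_mul_le_mul_left h hn0'
    linarith
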